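/- Two players have private values $v_1,v_2>0$ per unit of a divisible good and public budgets $B_1,B_2>0$. A polyhedral environment is a bounded set $X=\{x\in\mathbb R_+^2: Ax\le b\}$ with $A$ and $b$ entrywise nonnegative. A mechanism maps each valuation profile $v\in(0,\infty)^2$ to an allocation $x(v)\in\mathbb R^2$ and payments $p(v)\in\mathbb R^2$. For given $X$ and $B$, call it desirable if for all $v\in(0,\infty)^2$, all $i$ and all $v_i'>0$: - (feasibility and budget feasibility) $x(v)\in X$ and $p_i(v)\le B_i$; - (no positive transfers) $p_i(v)\ge 0$; - (individual rationality) $v_ix_i(v)-p_i(v)\ge 0$; - (truthfulness) $v_ix_i(v)-p_i(v)\ge v_ix_i(v_i',v_{-i})-p_i(v_i',v_{-i})$; - (Pareto-optimality) there are no $x'\in X$ and $p'\in\mathbb R^2$ with $p'\le B$ such that $v_jx_j'-p_j'\ge v_jx_j(v)-p_j(v)$ for every player $j$ and $\sum_j p_j'\ge\sum_j p_j(v)$, with at least one of these inequalities strict. Theorem. There is no general auction, i.e. no assignment of a mechanism to every two-player polyhedral environment $X$ and every pair of budgets $B_1,B_2>0$, such that the mechanism assigned to $(X,B)$ is always desirable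 for $(X,B)$. More precisely, $P=\{x\in\mathbb R_+^2: 2x_1+x_2\le 6,\ x_1+2x_2\le 6\}$ is a polyhedral environment, and no mechanism is desirable for $P$ and the budgets $B_1=B_2=1$. -/

import Mathlib

/-- The packing polytope `{x ∈ ℝ₊ⁿ : A x ≤ b}`. -/
def packingPolytope {m n : ℕ} (A : Matrix (Fin m) (Fin n) ℝ) (b : Fin m → ℝ) :
    Set (Fin n → ℝ) :=
  {x | (∀ i, 0 ≤ x i) ∧ ∀ j, (A.mulVec x) j ≤ b j}

/-- A polyhedral environment: a bounded packing polytope given by a nonnegative matrix and a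
nonnegative right-hand side. -/
def IsPolyhedralEnvironment {n : ℕ} (X : Set (Fin n → ℝ)) : Prop :=
  Bornology.IsBounded X ∧
    ∃ (m : ℕ) (A : Matrix (Fin m) (Fin n) ℝ) (b : Fin m → ℝ),
      (∀ j i, 0 ≤ A j i) ∧ (∀ j, 0 ≤ b j) ∧ X = packingPolytope A b

/-- A (direct, deterministic) mechanism for `n` players: an allocation rule and a payment rule.
The rules are total functions; every property below only looks at profiles of positive
valuations. -/
structure Mechanism (n : ℕ) where
  /-- the allocation `x(v)` -/
  alloc : (Fin n → ℝ) → (Fin n → ℝ)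
  /-- the payments `p(v)` -/
  pay : (Fin n → ℝ) → (Fin n → ℝ)

/-- The utility of a player with value `v` per unit who receives `x` and pays `p`
(within budget). -/
def utility (v x p : ℝ) : ℝ := v * x - p

/-- An outcome `(x, p)` is feasible if `x` lies in the environment and payments respect the
budgets. -/
def IsFeasibleOutcome {n : ℕ} (X : Set (Fin n → ℝ)) (B x p : Fin n → ℝ) : Prop :=
  x ∈ X ∧ ∀ i, p i ≤ B i

/-- `(x', p')` is a Pareto improvement on `(x, p)` at valuations `v`: no player's utility and
not the auctioneer's revenue decreases, and at least one of them increases. -/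
def IsParetoImprovement {n : ℕ} (v x p x' p' : Fin n → ℝ) : Prop :=
  (∀ i, utility (v i) (x i) (p i) ≤ utility (v i) (x' i) (p' i)) ∧
  ∑ i, p i ≤ ∑ i, p' i ∧
  ((∃ i, utility (v i) (x i) (p i) < utility (v i) (x' i) (p' i)) ∨
    ∑ i, p i < ∑ i, p' i)

/-- A feasible outcome is Pareto-optimal if no feasible outcome improves on it. -/
def IsParetoOptimalOutcome {n : ℕ} (X : Set (Fin n → ℝ)) (B v x p : Fin n → ℝ) : Prop :=
  IsFeasibleOutcome X B x p ∧
    ¬ ∃ x' p' : Fin n → ℝ, IsFeasibleOutcome X B x' p' ∧ IsParetoImprovement v x p x' p'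

namespace Mechanism

variable {n : ℕ}

/-- The allocation is always feasible. -/
def AllocFeasible (M : Mechanism n) (X : Set (Fin n → ℝ)) : Prop :=
  ∀ v : Fin n → ℝ, (∀ i, 0 < v i) → M.alloc v ∈ X

/-- No player is ever charged more than the budget. -/
def BudgetFeasible (M : Mechanism n) (B : Fin n → ℝ) : Prop :=
  ∀ v : Fin n → ℝ, (∀ i, 0 < v i) → ∀ i, M.pay v i ≤ B i

/-- The mechanism never pays a player. Together with truthfulness and individual rationality this
is the usual normalisation
`p i (v) = v i * x i (v) - ∫ u in 0..(v i), x i (u, v₋ᵢ)` of the payments. -/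
def NoPositiveTransfers (M : Mechanism n) : Prop :=
  ∀ v : Fin n → ℝ, (∀ i, 0 < v i) → ∀ i, 0 ≤ M.pay v i

/-- Voluntary participation: truthful players have nonnegative utility. -/
def IndividuallyRational (M : Mechanism n) : Prop :=
  ∀ v : Fin n → ℝ, (∀ i, 0 < v i) → ∀ i, 0 ≤ utility (v i) (M.alloc v i) (M.pay v i)

/-- Incentive compatibility: reporting the true value is a dominant strategy. -/
def Truthful (M : Mechanism n) : Prop :=
  ∀ v : Fin n → ℝ, (∀ i, 0 < v i) → ∀ i, ∀ w : ℝ, 0 < w →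
    utility (v i) (M.alloc (Function.update v i w) i) (M.pay (Function.update v i w) i) ≤
      utility (v i) (M.alloc v i) (M.pay v i)

/-- The mechanism always produces Pareto-optimal outcomes. -/
def ParetoOptimal (M : Mechanism n) (X : Set (Fin n → ℝ)) (B : Fin n → ℝ) : Prop :=
  ∀ v : Fin n → ℝ, (∀ i, 0 < v i) → IsParetoOptimalOutcome X B v (M.alloc v) (M.pay v)

/-- The desirable properties for the environment `X` and the budgets `B`. -/
structure Desirable (M : Mechanism n) (X : Set (Fin n → ℝ)) (B : Fin n → ℝ) : Prop where
  allocFeasible : M.AllocFeasible X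
  budgetFeasible : M.BudgetFeasible B
  noPositiveTransfers : M.NoPositiveTransfers
  individuallyRational : M.IndividuallyRational
  truthful : M.Truthful
  paretoOptimal : M.ParetoOptimal X B

end Mechanism

/-! The polygon has vertices (3,0), (2,2), (0,3). Suppose player `i` faces a value t < 1.
Pareto-optimality together with the budget gives `i` at least 2 units for every bid above t/2, hence
utility at least 2s - t at value s. For s > 2t, `i` either gets 3 units or pays the full budget 1;
letting s decrease to 2t bounds the allocation at value 2 below (`alloc_lower_bound`). The polygon
then leaves the opponent at most max(0, 3 - 1/t). By truthfulness, utility is the integral of the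
allocation, so against value 2 a player has utility at most about ∫_{1/3}^1 (3 - 1/u) du = 2 - ln 3
< 1 at value 1. With budget 1 this forces fewer than 2 units at value 2 (`alloc_lt_two`). At the
profile (2,2) both players thus get less than 2, and the vertex (2,2) is a Pareto improvement. -/

/-- The polygon `{x ∈ ℝ₊² : 2 x₀ + x₁ ≤ 6, x₀ + 2 x₁ ≤ 6}`. -/
def hardPolygon : Set (Fin 2 → ℝ) :=
  {x | 0 ≤ x 0 ∧ 0 ≤ x 1 ∧ 2 * x 0 + x 1 ≤ 6 ∧ x 0 + 2 * x 1 ≤ 6}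

theorem mem_hardPolygon_iff {i j : Fin 2} (hij : i ≠ j) {x : Fin 2 → ℝ} :
    x ∈ hardPolygon ↔ 0 ≤ x i ∧ 0 ≤ x j ∧ 2 * x i + x j ≤ 6 ∧ x i + 2 * x j ≤ 6 := by
  fin_cases i <;> fin_cases j <;> simp [hardPolygon] at hij ⊢
  constructor <;> rintro ⟨h₀, h₁, h₂, h₃⟩ <;> refine ⟨h₁, h₀, ?_, ?_⟩ <;> linarith

theorem isPolyhedralEnvironment_hardPolygon : IsPolyhedralEnvironment hardPolygon := by
  refine ⟨(Metric.isBounded_Icc (0 : Fin 2 → ℝ) (fun _ => 6)).subset ?_,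
    2, !![2, 1; 1, 2], ![6, 6], ?_, ?_, ?_⟩
  · rintro x ⟨h₀, h₁, h₂, h₃⟩
    refine ⟨fun i => ?_, fun i => ?_⟩ <;> fin_cases i <;> simp <;> linarith
  · intro j i
    fin_cases j <;> fin_cases i <;> simp
  · intro j
    fin_cases j <;> simp
  · ext x
    simp [hardPolygon, packingPolytope, Fin.forall_fin_two, Matrix.mulVec, dotProduct,
      Fin.sum_univ_two, and_assoc]

/-- The profile in which player `i` has value `s` and everyone else has value `t`. -/
def profile (i : Fin 2) (s t : ℝ) : Fin 2 → ℝ := Function.update (fun _ => t) i s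

theorem profile_self (i : Fin 2) (s t : ℝ) : profile i s t i = s := by simp [profile]

theorem profile_other {i j : Fin 2} (hij : i ≠ j) (s t : ℝ) : profile i s t j = t := by
  simp [profile, hij.symm]

theorem profile_comm {i j : Fin 2} (hij : i ≠ j) (s t : ℝ) : profile i s t = profile j t s := by
  funext k
  fin_cases i <;> fin_cases j <;> fin_cases k <;> simp [profile] at hij ⊢

theorem profile_pos {i : Fin 2} {s t : ℝ} (hs : 0 < s) (ht : 0 < t) (k : Fin 2) :
    0 < profile i s t k := by
  by_cases h : k = i
  · simpa [profile, h] using hs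
  · simpa [profile, h] using ht

theorem update_profile (i : Fin 2) (s t w : ℝ) :
    Function.update (profile i s t) i w = profile i w t := by
  simp [profile]

theorem sum_eq_add_of_ne {i j : Fin 2} (hij : i ≠ j) (f : Fin 2 → ℝ) :
    ∑ k, f k = f i + f j := by
  fin_cases i <;> fin_cases j <;> simp [Fin.sum_univ_two, add_comm] at hij ⊢

theorem forall_of_ne {i j : Fin 2} (hij : i ≠ j) {Q : Fin 2 → Prop} (hi : Q i) (hj : Q j) :
    ∀ k, Q k := by
  intro k
  fin_cases i <;> fin_cases j <;> fin_cases k <;> simp_all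

/-! ### Exchanges along the edges of the polygon -/

section ParetoOptimal

variable {v x p : Fin 2 → ℝ} {i j : Fin 2}

/-- A Pareto-optimal outcome has at least the welfare of every feasible outcome that is weakly
better for both players and the auctioneer. -/
theorem welfare_le_of_paretoOptimal
    (h : IsParetoOptimalOutcome hardPolygon (fun _ => 1) v x p) (hij : i ≠ j) {a b q r : ℝ}
    (ha : 0 ≤ a) (hb : 0 ≤ b) (h₁ : 2 * a + b ≤ 6) (h₂ : a + 2 * b ≤ 6) (hq : q ≤ 1) (hr : r ≤ 1)
    (hi : v i * x i - p i ≤ v i * a - q) (hj : v j * x j - p j ≤ v j * b - r)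
    (hs : p i + p j ≤ q + r) : v i * a + v j * b ≤ v i * x i + v j * x j := by
  by_contra! hlt
  refine h.2 ⟨profile i a b, profile i q r, ⟨?_, ?_⟩, ?_, ?_, ?_⟩
  · rw [mem_hardPolygon_iff hij, profile_self, profile_other hij]
    exact ⟨ha, hb, h₁, h₂⟩
  · exact forall_of_ne hij (by rwa [profile_self]) (by rwa [profile_other hij])
  · refine forall_of_ne hij ?_ ?_
    · simpa only [utility, profile_self] using hi
    · simpa only [utility, profile_other hij] using hj
  · rwa [sum_eq_add_of_ne hij, sum_eq_add_of_ne hij, profile_self, profile_other hij]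
  · by_contra! hc
    have hi' := hc.1 i
    have hj' := hc.1 j
    have hs' := hc.2
    rw [sum_eq_add_of_ne hij, sum_eq_add_of_ne hij] at hs'
    simp only [utility, profile_self, profile_other hij] at hi' hj' hs'
    linarith

/-- A player who would gain from an exchange at the rates `a : b` has exhausted the budget. -/
theorem one_le_pay_of_exchange
    (h : IsParetoOptimalOutcome hardPolygon (fun _ => 1) v x p) (hij : i ≠ j)
    (hvi : 0 < v i) {a b : ℝ} (ha : 0 < a) (hab : v j * b < v i * a)
    (hx : ∀ᶠ τ in nhdsWithin (0 : ℝ) (Set.Ioi 0), 0 ≤ x j - τ * b ∧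
      2 * (x i + τ * a) + (x j - τ * b) ≤ 6 ∧ (x i + τ * a) + 2 * (x j - τ * b) ≤ 6) :
    1 ≤ p i := by
  by_contra! hp
  have hbud : ∀ᶠ τ in nhdsWithin (0 : ℝ) (Set.Ioi 0), p i + v i * (τ * a) < 1 := by
    refine (ContinuousAt.eventually_lt (f := fun τ : ℝ => p i + v i * (τ * a))
      (by fun_prop) continuousAt_const ?_).filter_mono nhdsWithin_le_nhds
    simpa using hp
  obtain ⟨τ, ⟨hx₀, hx₁, hx₂⟩, hτp, hτ⟩ := (hx.and (hbud.and self_mem_nhdsWithin)).exists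
  have hτ : 0 < τ := hτ
  have hxi := ((mem_hardPolygon_iff hij).1 h.1.1).1
  have hpj : p j ≤ 1 := h.1.2 j
  have hgain : 0 < τ * (v i * a - v j * b) := mul_pos hτ (sub_pos.2 hab)
  -- Player `j` is compensated by a lower payment only when the exchange costs `j` something;
  -- otherwise the formula could push `j` over budget.
  rcases le_total (v j * b) 0 with hb | hb
  · have := welfare_le_of_paretoOptimal h hij (a := x i + τ * a) (b := x j - τ * b)
      (q := p i + v i * (τ * a)) (r := p j) (by positivity) hx₀ hx₁ hx₂ hτp.le hpj
      (by linarith) (by nlinarith [mul_nonneg hτ.le (neg_nonneg.2 hb)]) (by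
        have : 0 < v i * (τ * a) := by positivity
        linarith)
    nlinarith
  · have := welfare_le_of_paretoOptimal h hij (a := x i + τ * a) (b := x j - τ * b)
      (q := p i + v i * (τ * a)) (r := p j - v j * (τ * b)) (by positivity) hx₀ hx₁ hx₂ hτp.le
      (by nlinarith) (by linarith) (by linarith) (by linarith)
    nlinarith

/-- Left of the vertex (2,2) only the edge `x i + 2 * x j = 6` can bind, so `j` gives up one unit
for two of `i`'s, or nothing if `x j = 0`. -/
theorem one_le_pay_of_lt_two
    (h : IsParetoOptimalOutcome hardPolygon (fun _ => 1) v x p) (hij : i ≠ j)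
    (hvi : 0 < v i) (hv : v j < 2 * v i) (hx : x i < 2) : 1 ≤ p i := by
  obtain ⟨h₀, h₁, h₂, h₃⟩ := (mem_hardPolygon_iff hij).1 h.1.1
  rcases h₁.eq_or_lt with hj | hj
  · refine one_le_pay_of_exchange h hij hvi (a := 1) (b := 0) one_pos (by linarith) ?_
    filter_upwards [Ioo_mem_nhdsGT (show (0 : ℝ) < 1 / 2 by norm_num)] with τ hτ
    obtain ⟨hτ₀, hτ₁⟩ := hτ
    refine ⟨?_, ?_, ?_⟩ <;> linarith
  · refine one_le_pay_of_exchange h hij hvi (a := 2) (b := 1) two_pos (by linarith) ?_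
    filter_upwards [Ioo_mem_nhdsGT hj,
      Ioo_mem_nhdsGT (show (0 : ℝ) < 2 - (2 * x i + x j) / 3 by linarith)] with τ hτ hτ'
    obtain ⟨hτ₀, hτ₁⟩ := hτ
    have hτ₂ := hτ'.2
    refine ⟨?_, ?_, ?_⟩ <;> linarith

/-- The direction (1, -2) follows the steeper edge `2 * x i + x j = 6`, and preserves the other
constraint as well. -/
theorem one_le_pay_of_lt_three
    (h : IsParetoOptimalOutcome hardPolygon (fun _ => 1) v x p) (hij : i ≠ j)
    (hvi : 0 < v i) (hv : 2 * v j < v i) (hx : x i < 3) : 1 ≤ p i := by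
  obtain ⟨h₀, h₁, h₂, h₃⟩ := (mem_hardPolygon_iff hij).1 h.1.1
  rcases h₁.eq_or_lt with hj | hj
  · refine one_le_pay_of_exchange h hij hvi (a := 1) (b := 0) one_pos (by linarith) ?_
    filter_upwards [Ioo_mem_nhdsGT (show (0 : ℝ) < 3 - x i by linarith)] with τ hτ
    obtain ⟨hτ₀, hτ₁⟩ := hτ
    refine ⟨?_, ?_, ?_⟩ <;> linarith
  · refine one_le_pay_of_exchange h hij hvi (a := 1) (b := 2) one_pos (by linarith) ?_
    filter_upwards [Ioo_mem_nhdsGT (show (0 : ℝ) < x j / 2 by linarith)] with τ hτ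
    obtain ⟨hτ₀, hτ₁⟩ := hτ
    refine ⟨?_, ?_, ?_⟩ <;> linarith

theorem two_le_of_lt_two
    (h : IsParetoOptimalOutcome hardPolygon (fun _ => 1) v x p) (hij : i ≠ j)
    (hvi : 0 < v i) (hvj : 0 < v j) (hi : x i < 2) : 2 ≤ x j := by
  by_contra! hj
  have hpi : p i ≤ 1 := h.1.2 i
  have hpj : p j ≤ 1 := h.1.2 j
  have := welfare_le_of_paretoOptimal h hij (a := 2) (b := 2) (q := p i) (r := p j)
    (by norm_num) (by norm_num) (by norm_num) (by norm_num) hpi hpj (by nlinarith) (by nlinarith)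
    le_rfl
  nlinarith

end ParetoOptimal

/-! ### Truthfulness against the budget -/

namespace Mechanism.Desirable

variable {M : Mechanism 2} {i j : Fin 2}

theorem truthful_profile {X : Set (Fin 2 → ℝ)} {B : Fin 2 → ℝ} (hM : M.Desirable X B)
    {s t w : ℝ} (hs : 0 < s) (ht : 0 < t) (hw : 0 < w) :
    s * M.alloc (profile i w t) i - M.pay (profile i w t) i ≤
      s * M.alloc (profile i s t) i - M.pay (profile i s t) i := by
  simpa only [utility, profile_self, update_profile] using
    hM.truthful (profile i s t) (profile_pos hs ht) i w hw

theorem alloc_mono {X : Set (Fin 2 → ℝ)} {B : Fin 2 → ℝ} (hM : M.Desirable X B)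
    {s t w : ℝ} (hs : 0 < s) (ht : 0 < t) (hsw : s ≤ w) :
    M.alloc (profile i s t) i ≤ M.alloc (profile i w t) i := by
  rcases hsw.eq_or_lt with rfl | hlt
  · exact le_rfl
  have hw := hs.trans hlt
  have h₁ := hM.truthful_profile (i := i) hs ht hw
  have h₂ := hM.truthful_profile (i := i) hw ht hs
  nlinarith

theorem individuallyRational_profile {X : Set (Fin 2 → ℝ)} {B : Fin 2 → ℝ}
    (hM : M.Desirable X B) {s t : ℝ} (hs : 0 < s) (ht : 0 < t) :
    M.pay (profile i s t) i ≤ s * M.alloc (profile i s t) i := by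
  simpa only [utility, profile_self, sub_nonneg] using
    hM.individuallyRational (profile i s t) (profile_pos hs ht) i

/-- Against a value `t < 1`, a player bidding more than `t / 2` receives at least `2`. -/
theorem two_le_alloc (hM : M.Desirable hardPolygon (fun _ => 1)) (hij : i ≠ j) {s t : ℝ}
    (ht : 0 < t) (ht1 : t < 1) (hts : t / 2 < s) : 2 ≤ M.alloc (profile i s t) i := by
  -- At a bid `w < 1 / 2`, fewer than 2 units are worth less than the budget, so the budget cannot
  -- be exhausted; monotonicity carries the bound up to `s`.
  obtain ⟨w, hw, hw'⟩ := exists_between (lt_min hts (show t / 2 < 1 / 2 by linarith))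
  obtain ⟨hws, hw₂⟩ := lt_min_iff.1 hw'
  have hw₀ : 0 < w := by linarith
  refine le_trans ?_ (hM.alloc_mono hw₀ ht hws.le)
  by_contra! hlt
  have h₁ := one_le_pay_of_lt_two (hM.paretoOptimal (profile i w t) (profile_pos hw₀ ht)) hij
    (by rwa [profile_self]) (by rw [profile_self, profile_other hij]; linarith) hlt
  have h₂ := hM.individuallyRational_profile (i := i) hw₀ ht
  nlinarith

/-- Misreporting `w` just above `t / 2` yields at least 2 units at a unit price of at most `w`. -/
theorem utility_lower_bound (hM : M.Desirable hardPolygon (fun _ => 1)) (hij : i ≠ j) {s t : ℝ}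
    (ht : 0 < t) (ht1 : t < 1) (hts : t / 2 < s) :
    2 * s - t ≤ s * M.alloc (profile i s t) i - M.pay (profile i s t) i := by
  have key : ∀ w, t / 2 < w → w < s →
      2 * s - 2 * w ≤ s * M.alloc (profile i s t) i - M.pay (profile i s t) i := by
    intro w hw hws
    have hw₀ : 0 < w := by linarith
    have h₁ := hM.truthful_profile (i := i) (hw₀.trans hws) ht hw₀
    have h₂ := hM.individuallyRational_profile (i := i) hw₀ ht
    have h₃ := hM.two_le_alloc hij ht ht1 hw
    nlinarith
  by_contra! hlt
  obtain ⟨w, hw, hw'⟩ := exists_between (lt_min hts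
    (show t / 2 < (2 * s - (s * M.alloc (profile i s t) i - M.pay (profile i s t) i)) / 2 by
      linarith))
  obtain ⟨hws, hw₂⟩ := lt_min_iff.1 hw'
  linarith [key w hw hws]

/-- Against a value `t < 1`, a player with value `2` receives everything or at least
`(1 + 3 t) / (2 t)`. -/
theorem alloc_lower_bound (hM : M.Desirable hardPolygon (fun _ => 1)) (hij : i ≠ j) {t : ℝ}
    (ht : 0 < t) (ht1 : t < 1) :
    3 ≤ M.alloc (profile i 2 t) i ∨ 1 + 3 * t ≤ 2 * t * M.alloc (profile i 2 t) i := by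
  by_contra! hc
  obtain ⟨hc₁, hc₂⟩ := hc
  set z := M.alloc (profile i 2 t) i with hz
  have hz2 : 2 ≤ z := hM.two_le_alloc hij ht ht1 (by linarith)
  have hε : ∀ s, 2 * t < s → s ≤ 2 → 1 + 2 * s - t ≤ s * z := by
    intro s hs hs2
    have hs₀ : 0 < s := by linarith
    have hmono : M.alloc (profile i s t) i ≤ z := hM.alloc_mono hs₀ ht hs2
    have h₁ := one_le_pay_of_lt_three (hM.paretoOptimal (profile i s t) (profile_pos hs₀ ht)) hij
      (by rwa [profile_self]) (by rw [profile_self, profile_other hij]; linarith)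
      (hmono.trans_lt hc₁)
    have h₂ := hM.utility_lower_bound hij ht ht1 (s := s) (by linarith)
    nlinarith
  -- Since `0 ≤ z - 2 < 1`, moving `s` above `2 * t` by less than the gap in `hc₂` cannot close it.
  obtain ⟨s, hs, hs'⟩ := exists_between (lt_min (show 2 * t < 2 by linarith)
    (show 2 * t < 2 * t + (1 + 3 * t - 2 * t * z) by linarith))
  obtain ⟨hs2, hs₂⟩ := lt_min_iff.1 hs'
  have := hε s hs hs2.le
  nlinarith

/-- A player with value `t < 1` facing a value `2` receives at most `max 0 (3 - 1 / t)`. -/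
theorem alloc_upper_bound (hM : M.Desirable hardPolygon (fun _ => 1)) (hij : i ≠ j) {t c : ℝ}
    (ht : 0 < t) (ht1 : t < 1) (hc : 0 ≤ c) (htc : 3 * t - 1 ≤ t * c) :
    M.alloc (profile j t 2) j ≤ c := by
  obtain ⟨h₀, h₁, h₂, h₃⟩ := (mem_hardPolygon_iff hij).1
    (hM.allocFeasible (profile i 2 t) (profile_pos two_pos ht))
  rw [← profile_comm hij]
  rcases hM.alloc_lower_bound hij ht ht1 with h | h
  · linarith
  · refine le_of_mul_le_mul_left (le_trans ?_ htc) ht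
    nlinarith

/-- One step of an upper Riemann sum for utility as the integral of the allocation. -/
theorem utility_step {X : Set (Fin 2 → ℝ)} {B : Fin 2 → ℝ} (hM : M.Desirable X B)
    {s w t c d : ℝ} (hs : 0 < s) (ht : 0 < t) (hsw : s < w)
    (hc : M.alloc (profile i w t) i ≤ c)
    (hd : s * M.alloc (profile i s t) i - M.pay (profile i s t) i ≤ d) :
    w * M.alloc (profile i w t) i - M.pay (profile i w t) i ≤ d + (w - s) * c := by
  have h := hM.truthful_profile (i := i) hs ht (hs.trans hsw)
  nlinarith

theorem alloc_lt_two (hM : M.Desirable hardPolygon (fun _ => 1)) (hij : i ≠ j) :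
    M.alloc (profile j 2 2) j < 2 := by
  have bound : ∀ t c : ℝ, 0 < t → t < 1 → 0 ≤ c → 3 * t - 1 ≤ t * c →
      M.alloc (profile j t 2) j ≤ c := fun _ _ => hM.alloc_upper_bound hij
  have hpay := hM.noPositiveTransfers (profile j (1 / 3) 2)
    (profile_pos (by norm_num) two_pos) j
  -- The integral starts at 1/3, where 3 - 1/t vanishes; each later constant is 3 - 1/t at the right
  -- endpoint, except the final 2, a cruder bound.
  have u₀ : 1 / 3 * M.alloc (profile j (1 / 3) 2) j - M.pay (profile j (1 / 3) 2) j ≤ 0 := by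
    have := bound (1 / 3) 0 (by norm_num) (by norm_num) (by norm_num) (by norm_num)
    linarith
  have u₁ := hM.utility_step (w := 2 / 5) (by norm_num) two_pos (by norm_num)
    (bound _ (1 / 2) (by norm_num) (by norm_num) (by norm_num) (by norm_num)) u₀
  have u₂ := hM.utility_step (w := 1 / 2) (by norm_num) two_pos (by norm_num)
    (bound _ 1 (by norm_num) (by norm_num) (by norm_num) (by norm_num)) u₁
  have u₃ := hM.utility_step (w := 3 / 5) (by norm_num) two_pos (by norm_num)
    (bound _ (4 / 3) (by norm_num) (by norm_num) (by norm_num) (by norm_num)) u₂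
  have u₄ := hM.utility_step (w := 7 / 10) (by norm_num) two_pos (by norm_num)
    (bound _ (11 / 7) (by norm_num) (by norm_num) (by norm_num) (by norm_num)) u₃
  have u₅ := hM.utility_step (w := 4 / 5) (by norm_num) two_pos (by norm_num)
    (bound _ (7 / 4) (by norm_num) (by norm_num) (by norm_num) (by norm_num)) u₄
  have u₆ := hM.utility_step (w := 9 / 10) (by norm_num) two_pos (by norm_num)
    (bound _ (17 / 9) (by norm_num) (by norm_num) (by norm_num) (by norm_num)) u₅
  have u₇ := hM.utility_step (w := 99 / 100) (by norm_num) two_pos (by norm_num)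
    (bound _ 2 (by norm_num) (by norm_num) (by norm_num) (by norm_num)) u₆
  -- The range up to 2 is covered by the unknown allocation itself, whose coefficient 1.01 is below
  -- the 2 on the left.
  have u₈ := hM.utility_step (w := 2) (by norm_num) two_pos (by norm_num) le_rfl u₇
  have hB := hM.budgetFeasible (profile j 2 2) (profile_pos two_pos two_pos) j
  norm_num at u₈ hB
  linarith

end Mechanism.Desirable

theorem not_exists_desirable_hardPolygon :
    ¬ ∃ M : Mechanism 2, M.Desirable hardPolygon (fun _ => 1) := by
  rintro ⟨M, hM⟩
  have hne : (0 : Fin 2) ≠ 1 := by decide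
  have h₁ := hM.alloc_lt_two hne
  have h₀ := hM.alloc_lt_two hne.symm
  rw [← profile_comm hne] at h₁
  have hpos : ∀ k, 0 < profile 0 2 2 k := profile_pos two_pos two_pos
  exact h₁.not_ge (two_le_of_lt_two (hM.paretoOptimal _ hpos) hne (hpos 0) (hpos 1) h₀)

theorem mainTheorem3 :
    (¬ ∃ auction : Set (Fin 2 → ℝ) → (Fin 2 → ℝ) → Mechanism 2,
      ∀ (X : Set (Fin 2 → ℝ)) (B : Fin 2 → ℝ), IsPolyhedralEnvironment X → (∀ i, 0 < B i) →
        (auction X B).Desirable X B) ∧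
    (IsPolyhedralEnvironment
        {x : Fin 2 → ℝ | 0 ≤ x 0 ∧ 0 ≤ x 1 ∧ 2 * x 0 + x 1 ≤ 6 ∧ x 0 + 2 * x 1 ≤ 6} ∧
      ¬ ∃ M : Mechanism 2, M.Desirable
        {x : Fin 2 → ℝ | 0 ≤ x 0 ∧ 0 ≤ x 1 ∧ 2 * x 0 + x 1 ≤ 6 ∧ x 0 + 2 * x 1 ≤ 6}
        (fun _ => 1)) := by
  refine ⟨?_, isPolyhedralEnvironment_hardPolygon, not_exists_desirable_hardPolygon⟩
  rintro ⟨auction, h⟩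
  exact not_exists_desirable_hardPolygon
    ⟨_, h hardPolygon (fun _ => 1) isPolyhedralEnvironment_hardPolygon fun _ => one_pos⟩
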